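/- Notation. Throughout $q$ is a prime power and $k\ge 2$; a code is a set of $\mathbb F_q$-subspaces, and $\mathcal G_q(n,k)$ is the set of $k$-dimensional $\mathbb F_q$-subspaces of $\mathbb F_{q^n}$. For a subspace $V\subseteq\mathbb F_{q^n}$ put $\mathrm{Orb}(V)=\{\beta V:\beta\in\mathbb F_{q^n}^*\}$. If $\Phi_h:\mathbb F_{q^m}\to\mathbb F_{q^n}$ ($h\in H$) are injective $\mathbb F_q$-linear maps, $\mathcal C_2=\bigcup_{h}\mathrm{Orb}(\Phi_h(\mathbb F_{q^m}))$ and $\mathcal C_1\subseteq\mathcal G_q(m,k)$, put $\mathcal C_2\odot\mathcal C_1=\bigcup_{h}\bigcup_{U\in\mathcal C_1}\mathrm{Orb}(\Phi_h(U))\subseteq\mathcal G_q(n,k)$. The basic codes. Let $m\ge 1$ and let $\omega$ be a primitive element of $\mathbb F_{q^m}$. (a) If $q\ge 3$ and $\gamma\in\mathbb F_{q^{2m}}\setminus\mathbb F_{q^m}$ has norm $\mathrm N_{q^{2m}/q^m}(\gamma)=\omega$, then ${}_2\mathcal C_m\subseteq\mathcal G_q(2m,m)$ is the union of the orbits of the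 images of the maps $\mathbb F_{q^m}\to\mathbb F_{q^{2m}}$, $v\mapsto v+v^q\omega^h\gamma$, $0\le h\le\lfloor\frac{q-1}2\rfloor-1$. (b) If $p$ is an odd prime and $\gamma\in\mathbb F_{q^{pm}}$ satisfies $\mathbb F_{q^m}(\gamma)=\mathbb F_{q^{pm}}$, then ${}_p\mathcal C_m\subseteq\mathcal G_q(pm,m)$ is the union of the orbits of the images of the maps $\mathbb F_{q^m}\to\mathbb F_{q^{pm}}$, $$u\mapsto u\,(1+\alpha_1\gamma+\cdots+\alpha_{\ell_0}\gamma^{\ell_0})+\omega^j(u^q+au)\gamma^{\ell_1+1},$$ over all $0\le\ell_0\le\ell_1\le\frac{p-3}2$, $\alpha_1,\dots,\alpha_{\ell_0}\in\mathbb F_{q^m}$ with $\alpha_{\ell_0}\ne0$ if $\ell_0\ge 1$, $a\in\mathbb F_{q^m}$ and $0\le j\le q-2$. The new codes. Let $r=p_1p_2\cdots p_s$ with primes $p_1\le p_2\le\dots\le p_s$ (repeated according to multiplicity). Then $${}_r\mathcal C_k={}_{p_1}\mathcal C_{p_2\cdots p_sk}\odot\bigl({}_{p_2}\mathcal C_{p_3\cdots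 p_sk}\odot(\cdots\odot{}_{p_s}\mathcal C_{k})\bigr)\subseteq\mathcal G_q(rk,k),$$ where the elements $\omega,\gamma$ on each level may be chosen arbitrarily subject to (a) and (b). Sizes of the previously known codes in $\mathcal G_q(n,k)$ with minimum distance $2k-2$: * $n=2k$, $q>2$: $S_1(2k,k,q)=\lfloor\frac{q-1}2\rfloor\frac{q^{2k}-1}{q-1}$; * $n=4k$: $S_2(4k,k,q)=\lfloor\frac{q^k-2}2\rfloor(q^k-1)(q^{4k}-1)$; * $n=rk$, $r\ge3$, $\ell=\lceil\frac r2\rceil-2$: $S_3(rk,k,q)=q^k\frac{q^{(\ell+1)k}-1}{q^k-1}(q^{rk}-1)$; * $n=rk$, $r=2h+1$, $h\ge2$: $S_4(rk,k,q)=h\Bigl((q^k-1)^h(q^{rk}-1)+\frac{(q^k-1)^{h-1}(q^{rk}-1)}{q-1}\Bigr)$; * $n=rk$, $r=2h+1$, $h\ge2$: $S_5(rk,k,q)=hq^k(q^k-1)^{h-1}(q^{rk}-1)+\frac{q^{rk}-1}{q^k-1}$. **Theorem.** Let $r\ge6$ be a composite integer. Consider prime powers $q$, with $q\ge3$ if $r$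 is even. For every choice of the elements $\omega,\gamma$ in the construction of the codes ${}_r\mathcal C_k$ (a choice for each pair $(q,k)$), the following holds both as $k\to\infty$ with $q$ fixed, and as $q\to\infty$ through the prime powers with $k\ge2$ fixed: 1. $S_3(rk,k,q)=o(|{}_r\mathcal C_k|)$; 2. if $r$ is odd, then $S_4(rk,k,q)=o(|{}_r\mathcal C_k|)$ and $S_5(rk,k,q)=o(|{}_r\mathcal C_k|)$; 3. in particular, for $k$ (respectively $q$) sufficiently large, $|{}_r\mathcal C_k|$ is larger than each of the sizes listed above whose parameters apply to $n=rk$ and $q$. -/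

import Mathlib

open Filter Asymptotics

section NestedCodes

variable (F L : Type) [Field F] [Fintype F] [Field L] [Algebra F L]

/-- For a finite field `F` with `q` elements and an extension `L` of `F`, the intermediate field
`𝔽_{q^m}` of all `x` in `L` with `x ^ (q ^ m) = x`. If `L` has degree `n` over `F` and `m` divides
`n`, this is the unique subfield of `L` with `q ^ m` elements. -/
def subfieldOfDegree (m : ℕ) : IntermediateField F L where
  carrier := {x | x ^ (Fintype.card F ^ m) = x}
  mul_mem' := by
    intro a b ha hb
    simp only [Set.mem_ofPred_eq] at *
    rw [mul_pow, ha, hb]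
  add_mem' := by
    intro a b ha hb
    simp only [Set.mem_ofPred_eq] at *
    obtain ⟨p, hp⟩ := CharP.exists F
    obtain ⟨n, hpp, hn⟩ := FiniteField.card F p
    have : Fact p.Prime := ⟨hpp⟩
    have : CharP L p := charP_of_injective_algebraMap (algebraMap F L).injective p
    have hq : Fintype.card F ^ m = p ^ ((n : ℕ) * m) := by rw [hn, ← pow_mul]
    rw [hq] at ha hb ⊢
    rw [add_pow_char_pow, ha, hb]
  algebraMap_mem' := by
    intro a
    simp only [Set.mem_ofPred_eq]
    rw [← map_pow, FiniteField.pow_card_pow]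
  inv_mem' := by
    intro a ha
    simp only [Set.mem_ofPred_eq] at *
    rw [inv_pow, ha]

/-- `ω` is a primitive element of `𝔽_{q^m}`: a generator of its multiplicative group. -/
def IsPrimitiveElement (m : ℕ) (ω : L) : Prop :=
  ω ∈ subfieldOfDegree F L m ∧ orderOf ω = Fintype.card F ^ m - 1

variable {F L}

/-- The shift `β V = {β v : v ∈ V}`. -/
def shift (β : L) (V : Submodule F L) : Submodule F L :=
  V.map (LinearMap.mulLeft F β)

/-- The orbit `{β V : β ∈ N, β ≠ 0}` of `V` under the multiplicative group of the subfield `N`. -/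
def orb (N : IntermediateField F L) (V : Submodule F L) : Set (Submodule F L) :=
  {W | ∃ β ∈ N, β ≠ 0 ∧ W = shift β V}

/-- The cyclic code `⋃_Φ Orb(Φ(M))` whose representatives are the images of the field `M` under the
maps of a given family; the orbits are taken under the multiplicative group of `N`. -/
def multiOrbitCode (N M : IntermediateField F L) (maps : Set (L →ₗ[F] L)) :
    Set (Submodule F L) :=
  ⋃ Φ ∈ maps, orb N (M.toSubalgebra.toSubmodule.map Φ)

/-- The nesting `C₂ ⊙ C₁ = ⋃_Φ ⋃_{U ∈ C₁} Orb(Φ(U))`, where `C₁` is a code of subspaces of a field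
`M`, and `C₂ = ⋃_Φ Orb(Φ(M))` is given through the maps `Φ` that define its representatives (only
the restrictions of these maps to `M` matter). -/
def odot (N : IntermediateField F L) (maps : Set (L →ₗ[F] L)) (C₁ : Set (Submodule F L)) :
    Set (Submodule F L) :=
  ⋃ Φ ∈ maps, ⋃ U ∈ C₁, orb N (U.map Φ)

/-- Nesting into the one-word code `{𝔽_{q^m}}` gives back the code itself. -/
theorem odot_singleton (N : IntermediateField F L) (m : ℕ) (maps : Set (L →ₗ[F] L)) :
    odot N maps {(subfieldOfDegree F L m).toSubalgebra.toSubmodule} =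
      multiOrbitCode N (subfieldOfDegree F L m) maps := by
  simp [odot, multiOrbitCode]

variable (F) in
/-- The map `v ↦ v + v ^ q * (ω ^ h * γ)`. -/
noncomputable def twoMap (ω γ : L) (h : ℕ) : L →ₗ[F] L :=
  LinearMap.id + LinearMap.mulLeft F (ω ^ h * γ) ∘ₗ (FiniteField.frobeniusAlgHom F L).toLinearMap

variable (F) in
/-- The maps `v ↦ v + v ^ q * (ω ^ h * γ)` for `⌊(q - 1) / 2⌋` consecutive exponents
`h = 0, 1, …, ⌊(q - 1) / 2⌋ - 1`. -/
def twoMaps (ω γ : L) : Set (L →ₗ[F] L) :=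
  {Φ | ∃ h < (Fintype.card F - 1) / 2, Φ = twoMap F ω γ h}

/-- `P_α(γ) = 1 + α₁ γ + ⋯ + α_{ℓ₀} γ ^ ℓ₀`, where `α i` stands for `α_{i+1}`. -/
def polyP {ℓ₀ : ℕ} (α : Fin ℓ₀ → L) (γ : L) : L :=
  1 + ∑ i : Fin ℓ₀, α i * γ ^ ((i : ℕ) + 1)

variable (F) in
/-- The map `u ↦ u P_α(γ) + ω ^ j (u ^ q + a u) γ ^ (ℓ₁ + 1)`. -/
noncomputable def oddMap {ℓ₀ : ℕ} (ω γ : L) (α : Fin ℓ₀ → L) (a : L) (j ℓ₁ : ℕ) : L →ₗ[F] L :=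
  LinearMap.mulLeft F (polyP α γ) +
    LinearMap.mulLeft F (ω ^ j * γ ^ (ℓ₁ + 1)) ∘ₗ
      ((FiniteField.frobeniusAlgHom F L).toLinearMap + LinearMap.mulLeft F a)

variable (F) in
/-- All maps `u ↦ u P_α(γ) + ω ^ j (u ^ q + a u) γ ^ (ℓ₁ + 1)` with `0 ≤ ℓ₀ ≤ ℓ₁ ≤ (p - 3) / 2`,
`α ∈ 𝔽_{q^m} ^ ℓ₀` with nonzero last entry (no condition if `ℓ₀ = 0`), `a ∈ 𝔽_{q^m}` and
`0 ≤ j ≤ q - 2`. -/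
def oddMaps (p m : ℕ) (ω γ : L) : Set (L →ₗ[F] L) :=
  {Φ | ∃ ℓ₀ ℓ₁ : ℕ, ℓ₀ ≤ ℓ₁ ∧ ℓ₁ ≤ (p - 3) / 2 ∧
    ∃ α : Fin ℓ₀ → L, (∀ i, α i ∈ subfieldOfDegree F L m) ∧
      (∀ i : Fin ℓ₀, (i : ℕ) + 1 = ℓ₀ → α i ≠ 0) ∧
    ∃ a ∈ subfieldOfDegree F L m, ∃ j < Fintype.card F - 1, Φ = oddMap F ω γ α a j ℓ₁}

variable (F L) in
/-- `IsNestedCode F L k ps C` says that, for some choice of the auxiliary elements `ω` and `γ` on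
each level, `C` is the code
`₍p₁₎C_{p₂⋯p_s k} ⊙ (₍p₂₎C_{p₃⋯p_s k} ⊙ (⋯ ⊙ ₍p_s₎C_k))` of `k`-dimensional subspaces of
`𝔽_{q^(p₁⋯p_s k)}`, where `ps = [p₁, …, p_s]`, and where `₍p₎C_m` is the code in `𝒢_q(pm, m)` given
by the maps `twoMaps` if `p = 2` and `oddMaps` if `p` is odd. The last of these codes is nested into
the one-word code `{𝔽_{q^k}}`, which does not change it, see `odot_singleton`. -/
inductive IsNestedCode (k : ℕ) : List ℕ → Set (Submodule F L) → Prop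
  | nil : IsNestedCode k [] {(subfieldOfDegree F L k).toSubalgebra.toSubmodule}
  /-- Here `γ ^ (q ^ m + 1)` is the norm of `γ` from `𝔽_{q^(2m)}` to `𝔽_{q^m}`. -/
  | two (l : List ℕ) (C : Set (Submodule F L)) (m : ℕ) (ω γ : L)
      (hC : IsNestedCode k l C) (hm : m = l.prod * k)
      (hω : IsPrimitiveElement F L m ω)
      (hγ : γ ∈ subfieldOfDegree F L (2 * m)) (hγ' : γ ∉ subfieldOfDegree F L m)
      (hnorm : γ ^ (Fintype.card F ^ m + 1) = ω) :
      IsNestedCode k (2 :: l) (odot (subfieldOfDegree F L (2 * m)) (twoMaps F ω γ) C)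
  | odd (p : ℕ) (l : List ℕ) (C : Set (Submodule F L)) (m : ℕ) (ω γ : L)
      (hp : Odd p) (hC : IsNestedCode k l C) (hm : m = l.prod * k)
      (hω : IsPrimitiveElement F L m ω)
      (hγ : subfieldOfDegree F L m ⊔ IntermediateField.adjoin F {γ} =
        subfieldOfDegree F L (p * m)) :
      IsNestedCode k (p :: l) (odot (subfieldOfDegree F L (p * m)) (oddMaps F p m ω γ) C)

variable (F L) in
/-- `C` is a code `_rC_k` in `𝒢_q(rk, k)`. `Nat.primeFactorsList r` lists the prime factors of `r`
with multiplicity in increasing order, so the innermost code belongs to the largest prime factor of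
`r` and the outermost one to the smallest. -/
def IsNewCode (r k : ℕ) (C : Set (Submodule F L)) : Prop :=
  IsNestedCode F L k r.primeFactorsList C

end NestedCodes

/-- `N` is the number of codewords of a code `_rC_k` in `𝒢_q(rk, k)`, formed in a field `L = 𝔽_{q^(rk)}`
over a field `F = 𝔽_q`, for some choice of the auxiliary elements. -/
def IsNewCodeSize (q r k N : ℕ) : Prop :=
  ∃ (F L : Type) (_ : Field F) (_ : Fintype F) (_ : Field L) (_ : Algebra F L)
    (C : Set (Submodule F L)),
    Fintype.card F = q ∧ Module.finrank F L = r * k ∧ IsNewCode F L r k C ∧ N = C.ncard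

/-- `S₁(2k, k, q) = ⌊(q-1)/2⌋ (q^(2k) - 1) / (q - 1)`. -/
noncomputable def S₁ (k q : ℕ) : ℝ :=
  (((q - 1) / 2 : ℕ) : ℝ) * (((q : ℝ) ^ (2 * k) - 1) / ((q : ℝ) - 1))

/-- `S₂(4k, k, q) = ⌊(q^k-2)/2⌋ (q^k - 1) (q^(4k) - 1)`. -/
noncomputable def S₂ (k q : ℕ) : ℝ :=
  (((q ^ k - 2) / 2 : ℕ) : ℝ) * ((q : ℝ) ^ k - 1) * ((q : ℝ) ^ (4 * k) - 1)

/-- `S₃(rk, k, q) = q^k (q^((ℓ+1)k) - 1) / (q^k - 1) (q^(rk) - 1)` with `ℓ = ⌈r/2⌉ - 2`, for `r ≥ 3`;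
here `(r + 1) / 2` is `⌈r/2⌉`. -/
noncomputable def S₃ (r k q : ℕ) : ℝ :=
  (q : ℝ) ^ k * (((q : ℝ) ^ (((r + 1) / 2 - 2 + 1) * k) - 1) / ((q : ℝ) ^ k - 1)) *
    ((q : ℝ) ^ (r * k) - 1)

/-- `S₄(rk, k, q) = h ((q^k-1)^h (q^(rk)-1) + (q^k-1)^(h-1) (q^(rk)-1) / (q-1))`, for `r = 2h + 1`. -/
noncomputable def S₄ (h k q : ℕ) : ℝ :=
  (h : ℝ) * (((q : ℝ) ^ k - 1) ^ h * ((q : ℝ) ^ ((2 * h + 1) * k) - 1) +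
    ((q : ℝ) ^ k - 1) ^ (h - 1) * ((q : ℝ) ^ ((2 * h + 1) * k) - 1) / ((q : ℝ) - 1))

/-- `S₅(rk, k, q) = h q^k (q^k-1)^(h-1) (q^(rk)-1) + (q^(rk)-1) / (q^k-1)`, for `r = 2h + 1`. -/
noncomputable def S₅ (h k q : ℕ) : ℝ :=
  (h : ℝ) * (q : ℝ) ^ k * ((q : ℝ) ^ k - 1) ^ (h - 1) * ((q : ℝ) ^ ((2 * h + 1) * k) - 1) +
    ((q : ℝ) ^ ((2 * h + 1) * k) - 1) / ((q : ℝ) ^ k - 1)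

/-- The sizes of the previously known codes in `𝒢_q(rk, k)`, each for the parameters to which its
construction applies. -/
def knownSizes (r k q : ℕ) : Set ℝ :=
  {s | (r = 2 ∧ 2 < q ∧ s = S₁ k q) ∨ (r = 4 ∧ s = S₂ k q) ∨ (3 ≤ r ∧ s = S₃ r k q) ∨
    (∃ h, 2 ≤ h ∧ r = 2 * h + 1 ∧ s = S₄ h k q) ∨ (∃ h, 2 ≤ h ∧ r = 2 * h + 1 ∧ s = S₅ h k q)}

/-!
Every level of the nested code is built from maps `Φ : M → N` between finite fields, where
`M = 𝔽_{q^m}` and `N = 𝔽_{q^(pm)}`, with a Sidon property (`IsSidonFamily`): two distinct shifted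
images `β Φ(M)` and `β' Φ'(M)` have intersection of dimension at most one over `F = 𝔽_q`. The
reason is that independent vectors `β Φ(u₁) = Φ'(v₁)` and `β Φ(u₂) = Φ'(v₂)` in the intersection
of `β Φ(M)` and `Φ'(M)` satisfy `Φ(u₁) Φ'(v₂) = Φ(u₂) Φ'(v₁)`, which is a polynomial identity in
the generator `γ` of `N`. Comparing coefficients over `M` first gives `v₁ / u₁ = v₂ / u₂`, then
that this quotient is fixed by the Frobenius, that is, lies in `F`, and finally that `Φ = Φ'` and
`β ∈ F` (`isSidonFamily_twoMap`, `isSidonFamily_oddMap`).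

Consequently, if `C` consists of subspaces of `M` of dimension at least two, then the codewords
`β Φ(U)` with `U ∈ C` coincide only if `Φ` and `U` are the same and `β` is the same up to a factor
in `F`, so that nesting multiplies the sizes (`IsSidonFamily.card_mul_le`).

A lower bound for the size suffices, and it is so generous that only some of the maps are needed:
for `p = 2` a single one, and for odd `p` those with `ℓ₀ = ℓ₁ = (p - 3) / 2` and `j = 0`. Up to a
constant factor and a factor `q`, each level contributes `q ^ ((p + (p - 1) / 2) m)`. Summing the
exponents over the levels gives `nestedExponent`, which exceeds the exponent `r + ⌈r / 2⌉ - 1` of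
all the known sizes, by enough to absorb the lost factors `q`
(`length_add_le_two_mul_nestedExponent`). Thus the new code is larger than the known ones by a
factor of at least a constant times `q ^ (k - 1)` (`mul_pow_le_mul_size`), which tends to infinity
in both limits.
-/

/-! ### The subfields `𝔽_{q^m}` -/

section Subfields

variable {F L : Type} [Field F] [Fintype F] [Field L] [Algebra F L]

theorem mem_subfieldOfDegree {m : ℕ} {x : L} :
    x ∈ subfieldOfDegree F L m ↔ x ^ (Fintype.card F ^ m) = x := Iff.rfl

theorem add_pow_card (x y : L) :
    (x + y) ^ Fintype.card F = x ^ Fintype.card F + y ^ Fintype.card F :=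
  map_add (FiniteField.frobeniusAlgHom F L) x y

theorem add_pow_card_pow (m : ℕ) (x y : L) :
    (x + y) ^ Fintype.card F ^ m = x ^ Fintype.card F ^ m + y ^ Fintype.card F ^ m := by
  induction m with
  | zero => simp
  | succ m ih => simp only [pow_succ, pow_mul, ih, add_pow_card]

theorem sub_pow_card (x y : L) :
    (x - y) ^ Fintype.card F = x ^ Fintype.card F - y ^ Fintype.card F :=
  map_sub (FiniteField.frobeniusAlgHom F L) x y

theorem pow_card_mem {K : IntermediateField F L} {x : L} (hx : x ∈ K) :
    x ^ Fintype.card F ∈ K := pow_mem hx _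

theorem subfieldOfDegree_mono {m n : ℕ} (h : m ∣ n) :
    subfieldOfDegree F L m ≤ subfieldOfDegree F L n := by
  obtain ⟨d, rfl⟩ := h
  intro x hx
  rw [mem_subfieldOfDegree] at hx ⊢
  induction d with
  | zero => simp
  | succ d ih => rw [Nat.mul_succ, pow_add, pow_mul, ih, hx]

theorem frobenius_pow_apply [Finite L] (m : ℕ) (x : L) :
    ((FiniteField.frobeniusAlgEquivOfAlgebraic F L) ^ m) x = x ^ Fintype.card F ^ m := by
  rw [AlgEquiv.coe_pow, FiniteField.coe_frobeniusAlgEquivOfAlgebraic_iterate]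

theorem subfieldOfDegree_eq_fixedField [Finite L] (m : ℕ) :
    subfieldOfDegree F L m = IntermediateField.fixedField
      (Subgroup.zpowers ((FiniteField.frobeniusAlgEquivOfAlgebraic F L) ^ m)) := by
  ext x
  rw [IntermediateField.mem_fixedField_iff, mem_subfieldOfDegree, ← frobenius_pow_apply]
  constructor
  · intro h f hf
    have : Subgroup.zpowers ((FiniteField.frobeniusAlgEquivOfAlgebraic F L) ^ m) ≤
        MulAction.stabilizer Gal(L/F) x := by
      rw [Subgroup.zpowers_le]
      exact h
    exact this hf
  · intro h
    exact h _ (Subgroup.mem_zpowers _)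

/-- The degree of `𝔽_{q^m}` over `𝔽_q`, by Galois theory: `𝔽_{q^m}` is the fixed field of the
`m`-th power of the Frobenius. -/
theorem finrank_subfieldOfDegree [Finite L] {m : ℕ} (hm : m ∣ Module.finrank F L) :
    Module.finrank F (subfieldOfDegree F L m) = m := by
  have hpos : 0 < Module.finrank F L := Module.finrank_pos
  have h := IntermediateField.finrank_fixedField_eq_card
    (Subgroup.zpowers ((FiniteField.frobeniusAlgEquivOfAlgebraic F L) ^ m))
  rw [← subfieldOfDegree_eq_fixedField, Nat.card_zpowers, orderOf_pow,
    FiniteField.orderOf_frobeniusAlgEquivOfAlgebraic, Nat.gcd_eq_right hm] at h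
  have h2 := Module.finrank_mul_finrank F (subfieldOfDegree F L m) L
  rw [h] at h2
  obtain ⟨d, hd⟩ := hm
  have hm0 : 0 < m := Nat.pos_of_ne_zero (by rintro rfl; simp at hd; omega)
  have hd0 : 0 < d := Nat.pos_of_ne_zero (by rintro rfl; simp at hd; omega)
  rw [hd, Nat.mul_div_cancel_left _ hm0] at h2
  exact Nat.eq_of_mul_eq_mul_right hd0 h2

theorem card_subfieldOfDegree [Finite L] {m : ℕ} (hm : m ∣ Module.finrank F L) :
    Nat.card (subfieldOfDegree F L m) = Fintype.card F ^ m := by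
  rw [Module.natCard_eq_pow_finrank (K := F), finrank_subfieldOfDegree hm, Nat.card_eq_fintype_card]

/-- The elements of `L` fixed by the Frobenius `x ↦ x ^ q` are those of `F`. -/
theorem exists_algebraMap_eq_of_pow_card [Finite L] {x : L} (hx : x ^ Fintype.card F = x) :
    ∃ c : F, algebraMap F L c = x := by
  have h : x ∈ subfieldOfDegree F L 1 := by rwa [mem_subfieldOfDegree, pow_one]
  rw [IntermediateField.finrank_eq_one_iff.mp (finrank_subfieldOfDegree (one_dvd _))] at h
  exact IntermediateField.mem_bot.mp h

/-- Two elements `u` and `v` are linearly independent over `𝔽_q` if their Moore determinant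
`u v ^ q - v u ^ q` does not vanish. A subspace of dimension at least `2` contains such elements. -/
theorem exists_moore_ne_zero [Finite L] {U : Submodule F L} (hU : 2 ≤ Module.finrank F U) :
    ∃ u ∈ U, ∃ v ∈ U, u * v ^ Fintype.card F ≠ v * u ^ Fintype.card F := by
  by_contra! h
  have hne : U ≠ ⊥ := by rintro rfl; simp at hU
  obtain ⟨v, hv, hv0⟩ := U.ne_bot_iff.mp hne
  have hle : U ≤ Submodule.span F {v} := by
    intro u hu
    obtain ⟨c, hc⟩ := exists_algebraMap_eq_of_pow_card (F := F) (x := u / v) (by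
      have := h u hu v hv
      rw [div_pow]
      field_simp
      linear_combination -this)
    refine Submodule.mem_span_singleton.mpr ⟨c, ?_⟩
    rw [Algebra.smul_def, hc]
    field_simp
  have h1 := Submodule.finrank_mono hle
  have h2 := finrank_span_singleton (K := F) hv0
  omega

end Subfields

/-! ### Counting the codewords of a nested code -/

section Counting

variable {F L : Type} [Field F] [Field L] [Algebra F L]

theorem mem_odot {N : IntermediateField F L} {maps : Set (L →ₗ[F] L)}
    {C : Set (Submodule F L)} {W : Submodule F L} :
    W ∈ odot N maps C ↔
      ∃ Φ ∈ maps, ∃ U ∈ C, ∃ β ∈ N, β ≠ 0 ∧ W = shift β (U.map Φ) := by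
  simp [odot, orb]

theorem odot_mono {N : IntermediateField F L} {maps maps' : Set (L →ₗ[F] L)} {C D : Set (Submodule F L)}
    (hmaps : maps ⊆ maps') (hCD : C ⊆ D) : odot N maps C ⊆ odot N maps' D := by
  intro W hW
  obtain ⟨Φ, hΦ, U, hU, h⟩ := mem_odot.mp hW
  exact mem_odot.mpr ⟨Φ, hmaps hΦ, U, hCD hU, h⟩

theorem mem_shift_map {β x : L} {Φ : L →ₗ[F] L} {U : Submodule F L} :
    x ∈ shift β (U.map Φ) ↔ ∃ u ∈ U, β * Φ u = x := by
  simp [shift]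

theorem finrank_shift_map {β : L} (hβ : β ≠ 0) {Φ : L →ₗ[F] L} {U : Submodule F L}
    (hU : ∀ u ∈ U, Φ u = 0 → u = 0) :
    Module.finrank F (shift β (U.map Φ)) = Module.finrank F U := by
  have hcomp : shift β (U.map Φ) = U.map (LinearMap.mulLeft F β ∘ₗ Φ) := by
    rw [Submodule.map_comp]; rfl
  have hinj : Function.Injective ((LinearMap.mulLeft F β ∘ₗ Φ).domRestrict U) := by
    rw [← LinearMap.ker_eq_bot, LinearMap.ker_eq_bot']
    rintro ⟨u, hu⟩ h
    have h' : Φ u = 0 := by simpa [hβ] using h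
    exact Subtype.ext (hU u hu h')
  rw [hcomp, ← LinearMap.range_domRestrict]
  exact LinearMap.finrank_range_of_inj hinj

variable [Fintype F] {M N : IntermediateField F L}

/-- A family of injective linear maps `Φ i : M → N` (given as maps on `L`) such that
`β Φ i(M) ∩ Φ j(M)` has dimension at most `1` over `F`, except in the trivial case that `i = j` and
`β ∈ F`. That the preimages in `M` of two vectors in the intersection are linearly independent is
expressed by their Moore determinant. -/
structure IsSidonFamily (M N : IntermediateField F L) {ι : Type} (Φ : ι → L →ₗ[F] L) : Prop where
  map_mem : ∀ i, ∀ u ∈ M, Φ i u ∈ N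
  eq_zero_of_map_eq_zero : ∀ i, ∀ u ∈ M, Φ i u = 0 → u = 0
  eq_of_mul_map_eq : ∀ i j, ∀ β : L, β ≠ 0 → ∀ u₁ ∈ M, ∀ u₂ ∈ M, ∀ v₁ ∈ M, ∀ v₂ ∈ M,
    u₁ * u₂ ^ Fintype.card F ≠ u₂ * u₁ ^ Fintype.card F →
    β * Φ i u₁ = Φ j v₁ → β * Φ i u₂ = Φ j v₂ → i = j ∧ ∃ c : F, algebraMap F L c = β

theorem IsSidonFamily.eq_of_shift_eq [Finite L] {ι : Type} {Φ : ι → L →ₗ[F] L}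
    (hΦ : IsSidonFamily M N Φ) {i j : ι} {U V : Submodule F L} (hUM : ∀ u ∈ U, u ∈ M)
    (hVM : ∀ v ∈ V, v ∈ M) (hU : 2 ≤ Module.finrank F U) {β γ : L} (hβ : β ≠ 0) (hγ : γ ≠ 0)
    (h : shift β (U.map (Φ i)) = shift γ (V.map (Φ j))) :
    i = j ∧ U = V ∧ ∃ c : F, γ = algebraMap F L c * β := by
  have key : ∀ u ∈ U, ∃ v ∈ V, β / γ * Φ i u = Φ j v := by
    intro u hu
    have : β * Φ i u ∈ shift γ (V.map (Φ j)) := h ▸ mem_shift_map.mpr ⟨u, hu, rfl⟩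
    obtain ⟨v, hv, hvu⟩ := mem_shift_map.mp this
    refine ⟨v, hv, ?_⟩
    field_simp
    exact hvu.symm
  obtain ⟨u₁, hu₁, u₂, hu₂, hne⟩ := exists_moore_ne_zero hU
  obtain ⟨v₁, hv₁, h₁⟩ := key u₁ hu₁
  obtain ⟨v₂, hv₂, h₂⟩ := key u₂ hu₂
  obtain ⟨rfl, c, hc⟩ := hΦ.eq_of_mul_map_eq i j (β / γ) (div_ne_zero hβ hγ) u₁ (hUM _ hu₁) u₂
    (hUM _ hu₂) v₁ (hVM _ hv₁) v₂ (hVM _ hv₂) hne h₁ h₂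
  have hc0 : c ≠ 0 := by
    rintro rfl
    rw [map_zero] at hc
    exact div_ne_zero hβ hγ hc.symm
  have hle : U ≤ V := by
    intro u hu
    obtain ⟨v, hv, huv⟩ := key u hu
    have : u = c⁻¹ • v := by
      refine sub_eq_zero.mp (hΦ.eq_zero_of_map_eq_zero i _ ?_ ?_)
      · exact sub_mem (hUM _ hu) (hVM _ (V.smul_mem _ hv))
      · rw [map_sub, map_smul, ← huv, ← hc, ← Algebra.smul_def, smul_smul, inv_mul_cancel₀ hc0,
          one_smul, sub_self]
    exact this ▸ V.smul_mem _ hv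
  refine ⟨rfl, Submodule.eq_of_le_of_finrank_eq hle ?_, c⁻¹, ?_⟩
  · rw [← finrank_shift_map hβ fun u hu ↦ hΦ.eq_zero_of_map_eq_zero i u (hUM u hu), h,
      finrank_shift_map hγ fun u hu ↦ hΦ.eq_zero_of_map_eq_zero i u (hVM u hu)]
  · rw [map_inv₀, hc]
    field_simp

theorem IsSidonFamily.le_and_two_le_finrank {ι : Type} {Φ : ι → L →ₗ[F] L}
    (hΦ : IsSidonFamily M N Φ) {C : Set (Submodule F L)}
    (hC : ∀ U ∈ C, (∀ u ∈ U, u ∈ M) ∧ 2 ≤ Module.finrank F U) :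
    ∀ W ∈ odot N (Set.range Φ) C, (∀ w ∈ W, w ∈ N) ∧ 2 ≤ Module.finrank F W := by
  intro W hW
  obtain ⟨_, ⟨i, rfl⟩, U, hU, β, hβN, hβ, rfl⟩ := mem_odot.mp hW
  obtain ⟨hUM, hUd⟩ := hC U hU
  refine ⟨fun w hw ↦ ?_, ?_⟩
  · obtain ⟨u, hu, rfl⟩ := mem_shift_map.mp hw
    exact mul_mem hβN (hΦ.map_mem i u (hUM u hu))
  · rwa [finrank_shift_map hβ fun u hu ↦ hΦ.eq_zero_of_map_eq_zero i u (hUM u hu)]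

/-- The triples `(Φ i, U, β)` give every codeword `β Φ i(U)` at most `q` times, since `i` and `U`
are determined by the codeword and `β` is determined up to a factor in `F`. -/
theorem IsSidonFamily.card_mul_le [Finite L] {ι : Type} [Finite ι] {Φ : ι → L →ₗ[F] L}
    (hΦ : IsSidonFamily M N Φ)
    {C : Set (Submodule F L)} (hC : ∀ U ∈ C, (∀ u ∈ U, u ∈ M) ∧ 2 ≤ Module.finrank F U) :
    Nat.card ι * (C.ncard * (Nat.card N - 1)) ≤ Fintype.card F * (odot N (Set.range Φ) C).ncard := by
  classical
  have : Fintype L := Fintype.ofFinite L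
  have : Finite (Submodule F L) := Finite.of_injective _ SetLike.coe_injective
  have : Fintype (Submodule F L) := Fintype.ofFinite _
  have : Fintype ι := Fintype.ofFinite ι
  set s : Finset (ι × Submodule F L × L) :=
    Finset.univ ×ˢ C.toFinset ×ˢ ((N : Set L).toFinset.erase 0) with hs
  have hscard : s.card = Nat.card ι * (C.ncard * (Nat.card N - 1)) := by
    rw [hs, Finset.card_product, Finset.card_product, Finset.card_univ, Nat.card_eq_fintype_card,
      Set.ncard_eq_toFinset_card', Finset.card_erase_of_mem (by simp),
      show Nat.card N = (N : Set L).toFinset.card from Set.ncard_eq_toFinset_card' (N : Set L)]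
  set f : ι × Submodule F L × L → Submodule F L := fun t ↦ shift t.2.2 (t.2.1.map (Φ t.1)) with hf
  have himage : (s.image f).card ≤ (odot N (Set.range Φ) C).ncard := by
    rw [← Set.ncard_coe_finset]
    refine Set.ncard_le_ncard ?_ (Set.toFinite _)
    intro W hW
    simp only [hs, hf, Finset.coe_image, Set.mem_image, Finset.mem_coe, Finset.mem_product,
      Set.mem_toFinset, Finset.mem_erase, Finset.mem_univ, true_and] at hW
    obtain ⟨⟨i, U, β⟩, ⟨hU, hβ, hβN⟩, rfl⟩ := hW
    exact mem_odot.mpr ⟨Φ i, ⟨i, rfl⟩, U, hU, β, hβN, hβ, rfl⟩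
  rw [← hscard]
  refine (Finset.card_le_mul_card_image s (Fintype.card F) ?_).trans (Nat.mul_le_mul_left _ himage)
  intro W hW
  obtain ⟨⟨i, U, β⟩, ht, rfl⟩ := Finset.mem_image.mp hW
  simp only [hs, Finset.mem_product, Set.mem_toFinset, Finset.mem_erase, Finset.mem_univ,
    true_and] at ht
  have hsub : {t ∈ s | f t = f (i, U, β)} ⊆
      Finset.univ.image fun c : F ↦ (i, U, algebraMap F L c * β) := by
    rintro ⟨j, V, γ⟩ h
    simp only [hs, hf, Finset.mem_filter, Finset.mem_product, Set.mem_toFinset, Finset.mem_erase,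
      Finset.mem_univ, true_and] at h
    obtain ⟨rfl, rfl, c, rfl⟩ := hΦ.eq_of_shift_eq (hC U ht.1).1 (hC V h.1.1).1 (hC U ht.1).2
      ht.2.1 h.1.2.1 h.2.symm
    exact Finset.mem_image_of_mem _ (Finset.mem_univ c)
  exact (Finset.card_le_card hsub).trans (Finset.card_image_le.trans (Finset.card_univ).le)

end Counting

/-! ### The Sidon property of the basic codes -/

section Sidon

variable {F L : Type} [Field F] [Fintype F] [Field L] [Algebra F L]

theorem twoMap_zero_apply (ω γ u : L) : twoMap F ω γ 0 u = u + u ^ Fintype.card F * γ := by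
  simp [twoMap, mul_comm]

/-- A primitive element of `𝔽_{q^m}` is not a `(q - 1)`-th power if `q ≥ 3`. -/
theorem IsPrimitiveElement.mul_pow_card_ne {m : ℕ} (hm : m ≠ 0) (hq : 3 ≤ Fintype.card F) {ω d : L}
    (hω : IsPrimitiveElement F L m ω) (hd : d ∈ subfieldOfDegree F L m) (hd0 : d ≠ 0) :
    ω * d ^ Fintype.card F ≠ d := by
  intro h
  set q := Fintype.card F
  have hdq : ω * d ^ (q - 1) = 1 := by
    have : d ^ q = d ^ (q - 1) * d := by rw [← pow_succ]; congr 1; omega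
    rw [this, ← mul_assoc] at h
    exact mul_right_cancel₀ hd0 (h.trans (one_mul d).symm)
  have hqm : 1 < q ^ m := Nat.one_lt_pow hm (by omega)
  obtain ⟨s, hs⟩ := Nat.sub_one_dvd_pow_sub_one q m
  have hdm : d ^ (q ^ m - 1) = 1 := by
    have h1 : d ^ q ^ m = d := mem_subfieldOfDegree.mp hd
    have : d ^ q ^ m = d ^ (q ^ m - 1) * d := by rw [← pow_succ]; congr 1; omega
    rw [this] at h1
    exact mul_right_cancel₀ hd0 (h1.trans (one_mul d).symm)
  have hωs : ω ^ s = 1 := by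
    have := congrArg (· ^ s) hdq
    simpa [mul_pow, ← pow_mul, ← hs, hdm] using this
  have hs0 : 0 < s := Nat.pos_of_ne_zero (by rintro rfl; simp at hs; omega)
  have := Nat.le_of_dvd hs0 (orderOf_dvd_of_pow_eq_one hωs)
  rw [hω.2] at this
  nlinarith [show 2 ≤ q - 1 by omega]

theorem isSidonFamily_twoMap [Finite L] {m : ℕ} (hm : m ≠ 0) (hq : 3 ≤ Fintype.card F) {ω γ : L}
    (hω : IsPrimitiveElement F L m ω) (hγ : γ ∈ subfieldOfDegree F L (2 * m))
    (hγ' : γ ∉ subfieldOfDegree F L m) (hnorm : γ ^ (Fintype.card F ^ m + 1) = ω) :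
    IsSidonFamily (subfieldOfDegree F L m) (subfieldOfDegree F L (2 * m))
      (fun _ : Unit ↦ twoMap F ω γ 0) := by
  have hle : subfieldOfDegree F L m ≤ subfieldOfDegree F L (2 * m) :=
    subfieldOfDegree_mono (Dvd.intro_left _ rfl)
  have hind : ∀ a ∈ subfieldOfDegree F L m, ∀ b ∈ subfieldOfDegree F L m, a + b * γ = 0 →
      a = 0 ∧ b = 0 := by
    intro a ha b hb h
    by_cases hb0 : b = 0
    · simpa [hb0] using h
    · refine absurd ?_ hγ'
      have : γ = -a / b := by field_simp; linear_combination h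
      exact this ▸ div_mem (neg_mem ha) hb
  -- `γ` is a root of `X² - T X + ω`, where `T` is its trace over `𝔽_{q^m}`
  set T := γ + γ ^ Fintype.card F ^ m with hT
  have hTm : T ∈ subfieldOfDegree F L m := by
    have h2 : (γ ^ Fintype.card F ^ m) ^ Fintype.card F ^ m = γ := by
      rw [← pow_mul, ← pow_add, ← two_mul]; exact hγ
    rw [mem_subfieldOfDegree, hT, add_pow_card_pow, h2, add_comm]
  have hγ2 : γ * γ = T * γ - ω := by rw [hT, ← hnorm]; ring
  refine ⟨?_, ?_, ?_⟩
  · intro _ u hu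
    rw [twoMap_zero_apply]
    exact add_mem (hle hu) (mul_mem (hle (pow_card_mem hu)) hγ)
  · intro _ u hu h
    rw [twoMap_zero_apply] at h
    exact (hind _ hu _ (pow_card_mem hu) h).1
  · intro _ _ β hβ u₁ hu₁ u₂ hu₂ v₁ hv₁ v₂ hv₂ hne h₁ h₂
    simp only [twoMap_zero_apply] at h₁ h₂
    refine ⟨rfl, ?_⟩
    set q := Fintype.card F with hqdef
    have hq0 : q ≠ 0 := by omega
    have hu₁q : u₁ ^ q ∈ subfieldOfDegree F L m := pow_card_mem hu₁
    have hu₂q : u₂ ^ q ∈ subfieldOfDegree F L m := pow_card_mem hu₂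
    have hv₁q : v₁ ^ q ∈ subfieldOfDegree F L m := pow_card_mem hv₁
    have hv₂q : v₂ ^ q ∈ subfieldOfDegree F L m := pow_card_mem hv₂
    have hu₁0 : u₁ ≠ 0 := by rintro rfl; simp [hq0] at hne
    have hcross : (u₁ + u₁ ^ q * γ) * (v₂ + v₂ ^ q * γ) = (u₂ + u₂ ^ q * γ) * (v₁ + v₁ ^ q * γ) := by
      rw [← h₁, ← h₂]; ring
    -- the coefficients of `1` and `γ` in `hcross`, after reduction by `hγ2`
    obtain ⟨hc, hl⟩ := hind
      (u₁ * v₂ - ω * (u₁ ^ q * v₂ ^ q) - (u₂ * v₁ - ω * (u₂ ^ q * v₁ ^ q)))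
      (by
        have := hω.1
        exact sub_mem (sub_mem (mul_mem hu₁ hv₂) (mul_mem this (mul_mem hu₁q hv₂q)))
          (sub_mem (mul_mem hu₂ hv₁) (mul_mem this (mul_mem hu₂q hv₁q))))
      (u₁ * v₂ ^ q + u₁ ^ q * v₂ + T * (u₁ ^ q * v₂ ^ q) -
        (u₂ * v₁ ^ q + u₂ ^ q * v₁ + T * (u₂ ^ q * v₁ ^ q)))
      (sub_mem (add_mem (add_mem (mul_mem hu₁ hv₂q) (mul_mem hu₁q hv₂))
          (mul_mem hTm (mul_mem hu₁q hv₂q)))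
        (add_mem (add_mem (mul_mem hu₂ hv₁q) (mul_mem hu₂q hv₁))
          (mul_mem hTm (mul_mem hu₂q hv₁q))))
      (by linear_combination hcross - (u₁ ^ q * v₂ ^ q - u₂ ^ q * v₁ ^ q) * hγ2)
    -- otherwise `d = u₁ v₂ - u₂ v₁` has `ω d ^ q = d`
    have hw : u₁ * v₂ = u₂ * v₁ := by
      by_contra hw
      refine hω.mul_pow_card_ne hm hq (sub_mem (mul_mem hu₁ hv₂) (mul_mem hu₂ hv₁))
        (sub_ne_zero.mpr hw) ?_
      rw [sub_pow_card, mul_pow, mul_pow]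
      linear_combination -hc
    have hwq : u₁ ^ q * v₂ ^ q = u₂ ^ q * v₁ ^ q := by rw [← mul_pow, ← mul_pow, hw]
    obtain ⟨t, rfl⟩ : ∃ t, v₁ = t * u₁ := ⟨v₁ / u₁, by field_simp⟩
    obtain rfl : v₂ = t * u₂ := mul_left_cancel₀ hu₁0 (by linear_combination hw)
    have ht : t ^ q = t := by
      have hzero : (t ^ q - t) * (u₁ * u₂ ^ q - u₂ * u₁ ^ q) = 0 := by
        rw [mul_pow, mul_pow] at hl
        linear_combination hl
      exact sub_eq_zero.mp ((mul_eq_zero.mp hzero).resolve_right (sub_ne_zero.mpr hne))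
    obtain ⟨c, hc⟩ := exists_algebraMap_eq_of_pow_card (F := F) ht
    refine ⟨c, ?_⟩
    rw [hc]
    have hΦ : u₁ + u₁ ^ q * γ ≠ 0 := fun h ↦ hu₁0 (hind _ hu₁ _ hu₁q h).1
    refine mul_right_cancel₀ hΦ ?_
    rw [h₁, mul_pow, ht]; ring

end Sidon

section OddSidon

open Polynomial

/-- Comparison of coefficients in an identity between products of polynomials
`u P + c X ^ (ℓ + 1)` with `deg P ≤ ℓ` and `P(0) = 1`: the lowest, the highest and the middle
terms can be separated. -/
theorem cross_mul_eq {K : Type*} [Field K] {ℓ : ℕ} {P Q : K[X]} (hP : P.natDegree ≤ ℓ)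
    (hQ : Q.natDegree ≤ ℓ) (hP0 : P.coeff 0 = 1) (hQ0 : Q.coeff 0 = 1)
    {u₁ u₂ v₁ v₂ c₁ c₂ d₁ d₂ : K}
    (h : (C u₁ * P + C c₁ * X ^ (ℓ + 1)) * (C v₂ * Q + C d₂ * X ^ (ℓ + 1)) =
      (C u₂ * P + C c₂ * X ^ (ℓ + 1)) * (C v₁ * Q + C d₁ * X ^ (ℓ + 1))) :
    u₁ * v₂ = u₂ * v₁ ∧ c₁ * d₂ = c₂ * d₁ ∧
      C (u₁ * d₂ - u₂ * d₁) * P = C (v₁ * c₂ - v₂ * c₁) * Q := by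
  have h0 : u₁ * v₂ = u₂ * v₁ := by
    have := congrArg (coeff · 0) h
    simpa [mul_coeff_zero, hP0, hQ0] using this
  have h1 : C (u₁ * d₂ - u₂ * d₁) * P - C (v₁ * c₂ - v₂ * c₁) * Q =
      C (c₂ * d₁ - c₁ * d₂) * X ^ (ℓ + 1) := by
    have h0' : C u₁ * C v₂ = C u₂ * C v₁ := by rw [← C_mul, ← C_mul, h0]
    refine mul_left_cancel₀ (pow_ne_zero (ℓ + 1) (X_ne_zero (R := K))) ?_
    simp only [C_sub, C_mul]
    linear_combination h - P * Q * h0'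
  have h2 : c₁ * d₂ = c₂ * d₁ := by
    have := congrArg (coeff · (ℓ + 1)) h1
    simp only [coeff_sub, coeff_C_mul, coeff_X_pow, if_true, mul_one,
      coeff_eq_zero_of_natDegree_lt (Nat.lt_succ_of_le hP),
      coeff_eq_zero_of_natDegree_lt (Nat.lt_succ_of_le hQ)] at this
    linear_combination this
  refine ⟨h0, h2, sub_eq_zero.mp ?_⟩
  rw [h1, h2, sub_self, C_0, zero_mul]

/-- The polynomial `1 + α₁ X + ⋯ + α_ℓ X ^ ℓ`, whose value at `γ` is `polyP α γ`. -/
noncomputable def polynomialP {K : Type*} [Field K] {ℓ : ℕ} (α : Fin ℓ → K) : K[X] :=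
  1 + ∑ i : Fin ℓ, C (α i) * X ^ ((i : ℕ) + 1)

section

variable {K : Type*} [Field K] {ℓ : ℕ}

theorem coeff_zero_polynomialP (α : Fin ℓ → K) : (polynomialP α).coeff 0 = 1 := by
  simp [polynomialP, coeff_X_pow]

theorem coeff_succ_polynomialP (α : Fin ℓ → K) (i : Fin ℓ) :
    (polynomialP α).coeff (i + 1) = α i := by
  simp only [polynomialP, coeff_add, finsetSum_coeff, coeff_C_mul, coeff_X_pow, coeff_one]
  rw [Finset.sum_eq_single i]
  · simp
  · intro j _ hj
    have : (i : ℕ) ≠ j := fun h ↦ hj (Fin.ext h.symm)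
    simp [this]
  · simp

theorem natDegree_polynomialP_le (α : Fin ℓ → K) : (polynomialP α).natDegree ≤ ℓ := by
  refine natDegree_add_le_of_degree_le (by simp) (natDegree_sum_le_of_forall_le _ _ fun i _ ↦ ?_)
  exact (natDegree_C_mul_X_pow_le _ _).trans i.2

theorem natDegree_mul_polynomialP_add_le (α : Fin ℓ → K) (u c : K) :
    (C u * polynomialP α + C c * X ^ (ℓ + 1)).natDegree ≤ ℓ + 1 :=
  natDegree_add_le_of_degree_le
    (((natDegree_C_mul_le _ _).trans (natDegree_polynomialP_le α)).trans (Nat.le_succ ℓ))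
    (natDegree_C_mul_X_pow_le _ _)

end

variable {F L : Type} [Field F] [Fintype F] [Field L] [Algebra F L]

/-- If `γ` generates `𝔽_{q^(pm)}` over `𝔽_{q^m}`, then it is no root of a nonzero polynomial of
degree less than `p` over `𝔽_{q^m}`. -/
theorem eq_zero_of_aeval_eq_zero [Finite L] {p m : ℕ} (hn : p * m ∣ Module.finrank F L) {γ : L}
    (hγ : subfieldOfDegree F L m ⊔ IntermediateField.adjoin F {γ} = subfieldOfDegree F L (p * m))
    {g : (subfieldOfDegree F L m)[X]} (hg : g.natDegree < p) (h : aeval γ g = 0) : g = 0 := by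
  by_contra hg0
  set K := subfieldOfDegree F L m
  have hint : IsIntegral K γ := Algebra.IsIntegral.isIntegral γ
  have hdeg : Module.finrank K (IntermediateField.adjoin K {γ}) < p := by
    rw [IntermediateField.adjoin.finrank hint]
    exact (natDegree_le_of_dvd (minpoly.dvd K γ h) hg0).trans_lt hg
  have hle : subfieldOfDegree F L (p * m) ≤
      (IntermediateField.adjoin K {γ}).restrictScalars F := by
    rw [← hγ, sup_le_iff, IntermediateField.adjoin_le_iff, Set.singleton_subset_iff]
    refine ⟨fun x hx ↦ ?_, IntermediateField.mem_adjoin_simple_self K γ⟩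
    exact (IntermediateField.adjoin K {γ}).algebraMap_mem ⟨x, hx⟩
  have hcard : Nat.card (subfieldOfDegree F L (p * m)) ≤
      Nat.card (IntermediateField.adjoin K {γ}) :=
    Nat.card_mono (Set.toFinite _) hle
  rw [Module.natCard_eq_pow_finrank (K := K) (V := IntermediateField.adjoin K {γ}), card_subfieldOfDegree hn,
    card_subfieldOfDegree ((Dvd.intro_left _ rfl).trans hn), ← pow_mul] at hcard
  have hpos : 0 < p * m := Nat.pos_of_dvd_of_pos hn Module.finrank_pos
  have hm : 0 < m := Nat.pos_of_mul_pos_left hpos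
  have := (Nat.pow_le_pow_iff_right Fintype.one_lt_card).mp hcard
  rw [mul_comm] at this
  exact absurd (Nat.le_of_mul_le_mul_left this hm) (by omega)

theorem oddMap_apply_eq_aeval {m ℓ : ℕ} (ω γ : L) (α : Fin ℓ → subfieldOfDegree F L m)
    (a u : subfieldOfDegree F L m) :
    oddMap F ω γ (fun i ↦ (α i : L)) a 0 ℓ u =
      aeval γ (C u * polynomialP α + C (u ^ Fintype.card F + a * u) * X ^ (ℓ + 1)) := by
  simp [oddMap, polyP, polynomialP, IntermediateField.algebraMap_apply]
  ring

/-- The Sidon property of the maps `u ↦ u P_α(γ) + (u ^ q + a u) γ ^ (ℓ + 1)`, with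
`2 (ℓ + 1) < p`, so that products of two values are determined by their coefficients with respect
to powers of `γ`. -/
theorem isSidonFamily_oddMap [Finite L] {p m ℓ : ℕ} (hn : p * m ∣ Module.finrank F L)
    (hℓ : 2 * (ℓ + 1) < p) (ω γ : L)
    (hγ : subfieldOfDegree F L m ⊔ IntermediateField.adjoin F {γ} =
      subfieldOfDegree F L (p * m)) :
    IsSidonFamily (subfieldOfDegree F L m) (subfieldOfDegree F L (p * m))
      (fun t : (Fin ℓ → {x : subfieldOfDegree F L m // x ≠ 0}) × subfieldOfDegree F L m ↦
        oddMap F ω γ (fun i ↦ ((t.1 i : subfieldOfDegree F L m) : L)) t.2 0 ℓ) := by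
  set K := subfieldOfDegree F L m with hK
  set q := Fintype.card F with hqdef
  have hq0 : q ≠ 0 := Fintype.card_ne_zero
  have hind : ∀ g : K[X], g.natDegree < p → aeval γ g = 0 → g = 0 :=
    fun g ↦ eq_zero_of_aeval_eq_zero hn hγ
  have hinj : ∀ (α : Fin ℓ → K) (a u : K),
      oddMap F ω γ (fun i ↦ (α i : L)) a 0 ℓ u = 0 → u = 0 := by
    intro α a u h
    rw [oddMap_apply_eq_aeval] at h
    have h0 := hind _ ((natDegree_mul_polynomialP_add_le α u _).trans_lt (by omega)) h
    simpa [coeff_zero_polynomialP] using congrArg (coeff · 0) h0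
  refine ⟨?_, ?_, ?_⟩
  · rintro ⟨α, a⟩ u hu
    have hKN : K ≤ subfieldOfDegree F L (p * m) := hγ ▸ le_sup_left
    have hγN : γ ∈ subfieldOfDegree F L (p * m) :=
      hγ ▸ (le_sup_right : _ ≤ K ⊔ _) (IntermediateField.mem_adjoin_simple_self F γ)
    have := oddMap_apply_eq_aeval ω γ (fun i ↦ (α i).1) a ⟨u, hu⟩
    simp only at this ⊢
    rw [this, aeval_eq_sum_range]
    refine sum_mem fun i _ ↦ ?_
    rw [Algebra.smul_def]
    exact mul_mem (hKN (Subtype.property _)) (pow_mem hγN i)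
  · rintro ⟨α, a⟩ u hu h
    exact congrArg Subtype.val (hinj (fun i ↦ (α i).1) a ⟨u, hu⟩ h)
  -- Eliminating `β` gives `Φ(u₁) Φ'(v₂) = Φ(u₂) Φ'(v₁)`, an identity of polynomials in `γ` of
  -- degree less than `p`.
  · rintro ⟨α, a⟩ ⟨α', b⟩ β hβ u₁ hu₁ u₂ hu₂ v₁ hv₁ v₂ hv₂ hne h₁ h₂
    lift u₁ to K using hu₁
    lift u₂ to K using hu₂
    lift v₁ to K using hv₁
    lift v₂ to K using hv₂
    have hne' : u₁ * u₂ ^ q ≠ u₂ * u₁ ^ q := fun h ↦ hne (by exact_mod_cast congrArg Subtype.val h)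
    have hu₁0 : u₁ ≠ 0 := by rintro rfl; simp [hq0] at hne'
    have hv₁0 : v₁ ≠ 0 := by
      rintro rfl
      refine hu₁0 (hinj (fun i ↦ (α i).1) a u₁ ((mul_eq_zero.mp ?_).resolve_left hβ))
      simpa using h₁
    have e₁ := h₁
    have e₂ := h₂
    simp only [oddMap_apply_eq_aeval ω γ (fun i ↦ (α i).1) a,
      oddMap_apply_eq_aeval ω γ (fun i ↦ (α' i).1) b] at e₁ e₂
    set P := polynomialP fun i ↦ (α i).1 with hP
    set Q := polynomialP fun i ↦ (α' i).1 with hQ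
    have hcross : (C u₁ * P + C (u₁ ^ q + a * u₁) * X ^ (ℓ + 1)) *
          (C v₂ * Q + C (v₂ ^ q + b * v₂) * X ^ (ℓ + 1)) =
        (C u₂ * P + C (u₂ ^ q + a * u₂) * X ^ (ℓ + 1)) *
          (C v₁ * Q + C (v₁ ^ q + b * v₁) * X ^ (ℓ + 1)) := by
      refine sub_eq_zero.mp (hind _ (lt_of_le_of_lt (natDegree_sub_le_of_le
        (natDegree_mul_le_of_le (natDegree_mul_polynomialP_add_le _ _ _)
          (natDegree_mul_polynomialP_add_le _ _ _))
        (natDegree_mul_le_of_le (natDegree_mul_polynomialP_add_le _ _ _)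
          (natDegree_mul_polynomialP_add_le _ _ _))) ?_) ?_)
      · simp only [max_self]; omega
      · rw [map_sub, map_mul, map_mul, ← e₁, ← e₂]; ring
    obtain ⟨hlow, htop, hmid⟩ := cross_mul_eq (natDegree_polynomialP_le _)
      (natDegree_polynomialP_le _) (coeff_zero_polynomialP _) (coeff_zero_polynomialP _) hcross
    obtain ⟨t, rfl⟩ : ∃ t, v₁ = t * u₁ := ⟨v₁ / u₁, by field_simp⟩
    obtain rfl : v₂ = t * u₂ := mul_left_cancel₀ hu₁0 (by linear_combination hlow)
    -- all coefficients are now multiples of the Moore determinant of `u₁` and `u₂`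
    have ht0 : t ≠ 0 := left_ne_zero_of_mul hv₁0
    have hW : u₁ * u₂ ^ q - u₂ * u₁ ^ q ≠ 0 := sub_ne_zero.mpr hne'
    have hmid' : C (t ^ q * (u₁ * u₂ ^ q - u₂ * u₁ ^ q)) * P =
        C (t * (u₁ * u₂ ^ q - u₂ * u₁ ^ q)) * Q := by
      convert hmid using 3 <;> ring
    have ht : t ^ q = t := by
      have := congrArg (coeff · 0) hmid'
      simp only [coeff_C_mul, hP, hQ, coeff_zero_polynomialP, mul_one] at this
      exact mul_right_cancel₀ hW this
    have hPQ : P = Q := by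
      rw [ht] at hmid'
      exact mul_left_cancel₀ (C_ne_zero.mpr (mul_ne_zero ht0 hW)) hmid'
    have hab : a = b := by
      rw [mul_pow, mul_pow, ht] at htop
      have hz : (t * (u₁ * u₂ ^ q - u₂ * u₁ ^ q)) * (a - b) = 0 := by linear_combination htop
      exact sub_eq_zero.mp ((mul_eq_zero.mp hz).resolve_left (mul_ne_zero ht0 hW))
    have hα : α = α' := by
      funext i
      refine Subtype.ext ?_
      rw [← coeff_succ_polynomialP (fun i ↦ (α i).1) i,
        ← coeff_succ_polynomialP (fun i ↦ (α' i).1) i]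
      exact congrArg (coeff · (i + 1)) hPQ
    refine ⟨by rw [hα, hab], ?_⟩
    obtain ⟨c, hc⟩ := exists_algebraMap_eq_of_pow_card (F := F) (x := (t : L))
      (by exact_mod_cast congrArg Subtype.val ht)
    refine ⟨c, ?_⟩
    have hΦ : oddMap F ω γ (fun i ↦ ((α i).1 : L)) a 0 ℓ u₁ ≠ 0 :=
      fun h ↦ hu₁0 (hinj (fun i ↦ (α i).1) a u₁ h)
    refine mul_right_cancel₀ hΦ ?_
    simp only at h₁
    rw [h₁, ← hα, ← hab, ← Algebra.smul_def, ← map_smul, Algebra.smul_def, hc]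
    push_cast
    rfl

end OddSidon

/-! ### A lower bound for the size of a nested code -/

section LowerBound

/-- The exponent `E` such that the code `₍p₁₎C_{p₂⋯p_s k} ⊙ (⋯ ⊙ ₍p_s₎C_k)` has about `q ^ (k E)`
codewords, up to a constant factor and the factor `q ^ s`. For `p = 2` the summand
`(p - 1) / 2` vanishes. -/
def nestedExponent : List ℕ → ℕ
  | [] => 0
  | p :: l => (p + (p - 1) / 2) * l.prod + nestedExponent l

theorem le_two_mul_sub_one {a : ℕ} (ha : 2 ≤ a) : a ≤ 2 * (a - 1) := by omega

variable {F L : Type} [Field F] [Fintype F] [Field L] [Algebra F L]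

/-- The codewords that come from the single map with `h = 0` suffice for the bound; they form the
subcode `D`. -/
theorem pow_mul_ncard_le_of_two [Finite L] {m : ℕ} (hn : 2 * m ∣ Module.finrank F L)
    (hq : 3 ≤ Fintype.card F) {ω γ : L}
    (hω : IsPrimitiveElement F L m ω) (hγ : γ ∈ subfieldOfDegree F L (2 * m))
    (hγ' : γ ∉ subfieldOfDegree F L m) (hnorm : γ ^ (Fintype.card F ^ m + 1) = ω)
    {C : Set (Submodule F L)}
    (hC : ∀ U ∈ C, (∀ u ∈ U, u ∈ subfieldOfDegree F L m) ∧ 2 ≤ Module.finrank F U) :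
    ∃ D ⊆ odot (subfieldOfDegree F L (2 * m)) (twoMaps F ω γ) C,
      (∀ U ∈ D, (∀ u ∈ U, u ∈ subfieldOfDegree F L (2 * m)) ∧ 2 ≤ Module.finrank F U) ∧
      Fintype.card F ^ (2 * m) * C.ncard ≤ 2 ^ 2 * Fintype.card F * D.ncard := by
  have hpos : 0 < 2 * m := Nat.pos_of_dvd_of_pos hn Module.finrank_pos
  have hΦ := isSidonFamily_twoMap (by omega) hq hω hγ hγ' hnorm
  refine ⟨_, odot_mono ?_ subset_rfl, hΦ.le_and_two_le_finrank hC, ?_⟩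
  · rintro _ ⟨_, rfl⟩
    exact ⟨0, by omega, rfl⟩
  have h := hΦ.card_mul_le hC
  rw [card_subfieldOfDegree hn, Nat.card_unique, one_mul] at h
  have h1 : Fintype.card F ^ (2 * m) ≤ 2 * (Fintype.card F ^ (2 * m) - 1) :=
    le_two_mul_sub_one ((show 2 ≤ Fintype.card F by omega).trans
      (Nat.le_self_pow hpos.ne' _))
  calc _ ≤ 2 * (Fintype.card F ^ (2 * m) - 1) * C.ncard := Nat.mul_le_mul_right _ h1
    _ = 2 * (C.ncard * (Fintype.card F ^ (2 * m) - 1)) := by ring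
    _ ≤ 2 * (Fintype.card F * _) := Nat.mul_le_mul_left _ h
    _ ≤ _ := by rw [mul_assoc]; exact Nat.mul_le_mul_right _ (by norm_num)

/-- The codewords that come from the maps with `ℓ₀ = ℓ₁ = (p - 3) / 2`, `j = 0` and all `α i`
nonzero suffice for the bound; they form the subcode `D`. -/
theorem pow_mul_ncard_le_of_odd [Finite L] {p m : ℕ} (hp : Odd p) (hp2 : 2 ≤ p)
    (hn : p * m ∣ Module.finrank F L) {ω γ : L}
    (hγ : subfieldOfDegree F L m ⊔ IntermediateField.adjoin F {γ} =
      subfieldOfDegree F L (p * m))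
    {C : Set (Submodule F L)}
    (hC : ∀ U ∈ C, (∀ u ∈ U, u ∈ subfieldOfDegree F L m) ∧ 2 ≤ Module.finrank F U) :
    ∃ D ⊆ odot (subfieldOfDegree F L (p * m)) (oddMaps F p m ω γ) C,
      (∀ U ∈ D, (∀ u ∈ U, u ∈ subfieldOfDegree F L (p * m)) ∧ 2 ≤ Module.finrank F U) ∧
      Fintype.card F ^ ((p + (p - 1) / 2) * m) * C.ncard ≤
        2 ^ p * Fintype.card F * D.ncard := by
  obtain ⟨ℓ, rfl⟩ : ∃ ℓ, p = 2 * ℓ + 3 := by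
    obtain ⟨t, rfl⟩ := hp
    exact ⟨t - 1, by omega⟩
  have hpos : 0 < (2 * ℓ + 3) * m := Nat.pos_of_dvd_of_pos hn Module.finrank_pos
  have hm : 0 < m := Nat.pos_of_mul_pos_left hpos
  have hq : 2 ≤ Fintype.card F := Fintype.one_lt_card
  have hΦ := isSidonFamily_oddMap (ℓ := ℓ) hn (by omega) ω γ hγ
  refine ⟨_, odot_mono ?_ subset_rfl, hΦ.le_and_two_le_finrank hC, ?_⟩
  · rintro _ ⟨⟨α, a⟩, rfl⟩
    refine ⟨ℓ, ℓ, le_rfl, by omega, _, fun i ↦ (α i).1.2, fun i _ h ↦ (α i).2 (Subtype.ext h), a,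
      a.2, 0, by omega, rfl⟩
  have h := hΦ.card_mul_le hC
  have hcard : Nat.card {x : subfieldOfDegree F L m // x ≠ 0} = Fintype.card F ^ m - 1 := by
    classical
    have : Fintype (subfieldOfDegree F L m) := Fintype.ofFinite _
    rw [← card_subfieldOfDegree ((Dvd.intro_left _ rfl).trans hn), Nat.card_eq_fintype_card,
      Nat.card_eq_fintype_card, Fintype.card_subtype_compl, Fintype.card_subtype_eq]
  rw [Nat.card_prod, Nat.card_fun, hcard, Nat.card_eq_fintype_card, Fintype.card_fin,
    card_subfieldOfDegree hn, card_subfieldOfDegree ((Dvd.intro_left _ rfl).trans hn)] at h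
  have h1 : Fintype.card F ^ m ≤ 2 * (Fintype.card F ^ m - 1) :=
    le_two_mul_sub_one (hq.trans (Nat.le_self_pow hm.ne' _))
  have h2 : Fintype.card F ^ ((2 * ℓ + 3) * m) ≤ 2 * (Fintype.card F ^ ((2 * ℓ + 3) * m) - 1) :=
    le_two_mul_sub_one (hq.trans (Nat.le_self_pow hpos.ne' _))
  have hexp : (2 * ℓ + 3 + (2 * ℓ + 3 - 1) / 2) * m = m * ℓ + m + (2 * ℓ + 3) * m := by
    rw [show (2 * ℓ + 3 - 1) / 2 = ℓ + 1 by omega]; ring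
  rw [hexp, pow_add, pow_add, pow_mul]
  calc _ ≤ (2 * (Fintype.card F ^ m - 1)) ^ ℓ * Fintype.card F ^ m *
        (2 * (Fintype.card F ^ ((2 * ℓ + 3) * m) - 1)) * C.ncard := by gcongr
    _ = 2 ^ (ℓ + 1) * ((Fintype.card F ^ m - 1) ^ ℓ * Fintype.card F ^ m *
        (C.ncard * (Fintype.card F ^ ((2 * ℓ + 3) * m) - 1))) := by
      rw [mul_pow]; ring
    _ ≤ 2 ^ (ℓ + 1) * (Fintype.card F * _) := Nat.mul_le_mul_left _ h
    _ ≤ 2 ^ (2 * ℓ + 3) * (Fintype.card F * _) :=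
      Nat.mul_le_mul_right _ (Nat.pow_le_pow_right (by norm_num) (by omega))
    _ = _ := by ring

theorem two_le_finrank_subfieldOfDegree [Finite L] {k : ℕ} (hk : 2 ≤ k)
    (hn : k ∣ Module.finrank F L) :
    2 ≤ Module.finrank F (subfieldOfDegree F L k).toSubalgebra.toSubmodule :=
  hk.trans (finrank_subfieldOfDegree hn).ge

/-- The size of a nested code is bounded below by that of a subcode, formed from only some of the
maps on each level. Its codewords have dimension at least `2`, as the next nesting requires. -/
theorem IsNestedCode.exists_subcode [Finite L] {k : ℕ} (hk : 2 ≤ k) {l : List ℕ}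
    {C : Set (Submodule F L)} (h : IsNestedCode F L k l C) (hl : ∀ p ∈ l, 2 ≤ p)
    (hq : 2 ∈ l → 3 ≤ Fintype.card F) (hn : l.prod * k ∣ Module.finrank F L) :
    ∃ D ⊆ C, (∀ U ∈ D, (∀ u ∈ U, u ∈ subfieldOfDegree F L (l.prod * k)) ∧
        2 ≤ Module.finrank F U) ∧
      Fintype.card F ^ (k * nestedExponent l) ≤
        2 ^ l.sum * Fintype.card F ^ l.length * D.ncard := by
  have step : ∀ {p e c x y : ℕ} {l : List ℕ},
      Fintype.card F ^ (e * (l.prod * k)) * x ≤ 2 ^ p * Fintype.card F * y →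
      Fintype.card F ^ (k * c) ≤ 2 ^ l.sum * Fintype.card F ^ l.length * x →
      Fintype.card F ^ (k * (e * l.prod + c)) ≤
        2 ^ (p + l.sum) * Fintype.card F ^ (l.length + 1) * y := by
    intro p e c x y l h₁ h₂
    calc Fintype.card F ^ (k * (e * l.prod + c))
        = Fintype.card F ^ (e * (l.prod * k)) * Fintype.card F ^ (k * c) := by
          rw [← pow_add]; congr 1; ring
      _ ≤ Fintype.card F ^ (e * (l.prod * k)) * _ := Nat.mul_le_mul_left _ h₂
      _ = 2 ^ l.sum * Fintype.card F ^ l.length * (Fintype.card F ^ (e * (l.prod * k)) * x) := by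
          ring
      _ ≤ 2 ^ l.sum * Fintype.card F ^ l.length * _ := Nat.mul_le_mul_left _ h₁
      _ = _ := by ring
  induction h with
  | nil =>
    refine ⟨_, subset_rfl, ?_, by simp [nestedExponent]⟩
    rintro _ rfl
    rw [List.prod_nil, one_mul] at hn ⊢
    exact ⟨fun u hu ↦ hu, two_le_finrank_subfieldOfDegree hk hn⟩
  | two l C m ω γ hC hm hω hγ hγ' hnorm ih =>
    subst hm
    rw [List.prod_cons, mul_assoc] at hn ⊢
    obtain ⟨D, hDC, hD, hbound⟩ := ih (fun p hp ↦ hl p (List.mem_cons_of_mem _ hp))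
      (fun h ↦ hq (List.mem_cons_of_mem _ h)) ((Dvd.intro_left _ rfl).trans hn)
    obtain ⟨D', hD'D, hD', hbound'⟩ := pow_mul_ncard_le_of_two hn (hq List.mem_cons_self) hω hγ hγ'
      hnorm hD
    exact ⟨D', hD'D.trans (odot_mono subset_rfl hDC), hD', step hbound' hbound⟩
  | odd p l C m ω γ hp hC hm hω hγ ih =>
    subst hm
    rw [List.prod_cons, mul_assoc] at hn ⊢
    obtain ⟨D, hDC, hD, hbound⟩ := ih (fun p hp ↦ hl p (List.mem_cons_of_mem _ hp))
      (fun h ↦ hq (List.mem_cons_of_mem _ h)) ((Dvd.intro_left _ rfl).trans hn)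
    obtain ⟨D', hD'D, hD', hbound'⟩ := pow_mul_ncard_le_of_odd (ω := ω) hp
      (hl p List.mem_cons_self) hn hγ hD
    exact ⟨D', hD'D.trans (odot_mono subset_rfl hDC), hD', step hbound' hbound⟩

theorem three_mul_prod_add_length_le {l : List ℕ} (hl : ∀ p ∈ l, p.Prime) :
    3 * l.prod + l.length ≤ 2 * nestedExponent l + 3 := by
  induction l with
  | nil => simp [nestedExponent]
  | cons p l ih =>
    have ih := ih fun p hp ↦ hl p (List.mem_cons_of_mem _ hp)
    have hprod : 0 < l.prod :=
      List.prod_pos fun p hp ↦ (hl p (List.mem_cons_of_mem _ hp)).pos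
    have hp := hl p List.mem_cons_self
    simp only [nestedExponent, List.prod_cons, List.length_cons]
    obtain rfl | hodd := hp.eq_two_or_odd'
    · norm_num
      omega
    · obtain ⟨t, rfl⟩ := hodd
      rw [show (2 * t + 1 - 1) / 2 = t by omega]
      nlinarith

/-- The exponent of the nested code exceeds the exponent `r + ⌈r / 2⌉ - 1` of the known codes, by
enough to make up for the factors `q` that are lost in the lower bound. -/
theorem length_add_le_two_mul_nestedExponent {r : ℕ} (hr : 6 ≤ r) (hcomp : ¬ r.Prime) :
    2 * (r + (r + 1) / 2 - 1) + r.primeFactorsList.length + 1 ≤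
      2 * nestedExponent r.primeFactorsList := by
  have hdiv : r.minFac * (r / r.minFac) = r := Nat.mul_div_cancel' (Nat.minFac_dvd r)
  have hmin : r.minFac.Prime := Nat.minFac_prime (by omega)
  have hlist : r.primeFactorsList = r.minFac :: (r / r.minFac).primeFactorsList := by
    obtain ⟨n, rfl⟩ : ∃ n, r = n + 2 := ⟨r - 2, by omega⟩
    rw [Nat.primeFactorsList]
  have hm0 : r / r.minFac ≠ 0 := by intro h; rw [h] at hdiv; omega
  have hm1 : r / r.minFac ≠ 1 := by
    intro h
    rw [h, mul_one] at hdiv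
    exact hcomp (hdiv ▸ hmin)
  have hb := three_mul_prod_add_length_le
    fun p (hp : p ∈ (r / r.minFac).primeFactorsList) ↦ Nat.prime_of_mem_primeFactorsList hp
  rw [Nat.prod_primeFactorsList hm0] at hb
  rw [hlist, nestedExponent, List.length_cons, Nat.prod_primeFactorsList hm0]
  generalize r / r.minFac = m at *
  obtain h2 | hodd := hmin.eq_two_or_odd'
  · rw [h2] at hdiv ⊢
    norm_num
    omega
  · obtain ⟨t, ht⟩ := hodd
    rw [show (r.minFac - 1) / 2 = t by omega]
    rw [ht] at hdiv ⊢
    have : (2 * t + 1 + t) * m = r + t * m := by rw [add_mul, hdiv]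
    have h3 : 2 * (t * m) + m = r := by rw [← hdiv]; ring
    rw [this]
    omega

theorem IsNewCodeSize.two_le {q r k N : ℕ} (h : IsNewCodeSize q r k N) : 2 ≤ q := by
  obtain ⟨F, L, _, _, _, _, C, rfl, -⟩ := h
  exact Fintype.one_lt_card

/-- The new codes are larger than `q ^ (k (r + ⌈r / 2⌉ - 1))`, essentially by the factor
`q ^ (k - 1)`. -/
theorem IsNewCodeSize.pow_le {q r k N : ℕ} (h : IsNewCodeSize q r k N) (hk : 2 ≤ k) (hr : 6 ≤ r)
    (hcomp : ¬ r.Prime) (hq : Even r → 3 ≤ q) :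
    q ^ (k * (r + (r + 1) / 2 - 1)) * q ^ (k - 1) ≤ 2 ^ r.primeFactorsList.sum * N := by
  obtain ⟨F, L, _, _, _, _, C, rfl, hfin, hC, rfl⟩ := h
  have : Module.Finite F L := Module.finite_of_finrank_pos (by rw [hfin]; positivity)
  have : Finite L := Module.finite_of_finite F
  have : Finite (Submodule F L) := Finite.of_injective _ SetLike.coe_injective
  obtain ⟨D, hDC, -, hD⟩ := IsNestedCode.exists_subcode hk hC
    (fun p hp ↦ (Nat.prime_of_mem_primeFactorsList hp).two_le)
    (fun h ↦ hq (even_iff_two_dvd.mpr (Nat.dvd_of_mem_primeFactorsList h)))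
    (by rw [Nat.prod_primeFactorsList (by omega), hfin])
  have hq1 : 0 < Fintype.card F := Fintype.card_pos
  have hexp := length_add_le_two_mul_nestedExponent hr hcomp
  set T := r + (r + 1) / 2 - 1
  set E := nestedExponent r.primeFactorsList
  set s := r.primeFactorsList.length
  have hE : k * T + (k - 1) + s ≤ k * E := by
    obtain ⟨j, rfl⟩ : ∃ j, k = j + 2 := ⟨k - 2, by omega⟩
    have : j * (T + 1) ≤ j * E := Nat.mul_le_mul_left _ (by omega)
    rw [add_mul, add_mul]
    rw [mul_add] at this
    omega
  have h1 : Fintype.card F ^ (k * T + (k - 1)) * Fintype.card F ^ s ≤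
      2 ^ r.primeFactorsList.sum * D.ncard * Fintype.card F ^ s := by
    rw [← pow_add]
    refine (Nat.pow_le_pow_right hq1 hE).trans (hD.trans_eq ?_)
    ring
  rw [← pow_add]
  refine (Nat.le_of_mul_le_mul_right h1 (pow_pos hq1 s)).trans (Nat.mul_le_mul_left _ ?_)
  exact Set.ncard_le_ncard hDC (Set.toFinite _)

end LowerBound

/-! ### Comparison with the known sizes -/

section KnownSizes

theorem two_le_cast_pow {q k : ℕ} (hq : 2 ≤ q) (hk : k ≠ 0) : (2 : ℝ) ≤ (q : ℝ) ^ k := by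
  exact_mod_cast hq.trans (Nat.le_self_pow hk q)

theorem S₃_nonneg_and_le {r k q : ℕ} (hr : 6 ≤ r) (hk : k ≠ 0) (hq : 2 ≤ q) :
    0 ≤ S₃ r k q ∧ S₃ r k q ≤ r * (q : ℝ) ^ (k * (r + (r + 1) / 2 - 1)) := by
  obtain ⟨a, ha⟩ : ∃ a, (r + 1) / 2 = a + 2 := ⟨(r + 1) / 2 - 2, by omega⟩
  have hT : r + (r + 1) / 2 - 1 = 1 + a + r := by omega
  rw [S₃, hT, ha, Nat.add_sub_cancel, mul_comm _ k, mul_comm r k, pow_mul, pow_mul, pow_mul]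
  have hQ := two_le_cast_pow hq hk
  set Q : ℝ := (q : ℝ) ^ k
  have hr' : (2 : ℝ) ≤ r := by exact_mod_cast (show 2 ≤ r by omega)
  have h1 : ∀ n, 1 ≤ Q ^ n := fun n ↦ one_le_pow₀ (by linarith)
  have hgeom0 : 0 ≤ (Q ^ (a + 1) - 1) / (Q - 1) :=
    div_nonneg (sub_nonneg.mpr (h1 _)) (by linarith)
  have hgeom : (Q ^ (a + 1) - 1) / (Q - 1) ≤ 2 * Q ^ a := by
    rw [div_le_iff₀ (by linarith), pow_succ]
    nlinarith [h1 a]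
  have hr0 : 0 ≤ Q ^ r - 1 := sub_nonneg.mpr (h1 _)
  refine ⟨by positivity, ?_⟩
  calc _ ≤ Q * (2 * Q ^ a) * Q ^ r := by gcongr; linarith
    _ = 2 * Q ^ (1 + a + r) := by ring
    _ ≤ _ := by gcongr

theorem S₄_nonneg_and_le {h k q : ℕ} (hh : 1 ≤ h) (hk : k ≠ 0) (hq : 2 ≤ q) :
    0 ≤ S₄ h k q ∧ S₄ h k q ≤
      (2 * h + 1 : ℕ) * (q : ℝ) ^ (k * (2 * h + 1 + (2 * h + 1 + 1) / 2 - 1)) := by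
  obtain ⟨a, rfl⟩ : ∃ a, h = a + 1 := ⟨h - 1, by omega⟩
  have hT : 2 * (a + 1) + 1 + (2 * (a + 1) + 1 + 1) / 2 - 1 = (a + 1) + (2 * (a + 1) + 1) := by omega
  rw [S₄, hT, Nat.add_sub_cancel, mul_comm _ k, pow_mul, pow_mul]
  have hQ := two_le_cast_pow hq hk
  have hq' : (2 : ℝ) ≤ q := by exact_mod_cast hq
  set Q : ℝ := (q : ℝ) ^ k
  set R := Q ^ (2 * (a + 1) + 1) with hR
  have hR1 : 1 ≤ R := one_le_pow₀ (by linarith)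
  have hR0 : 0 ≤ R - 1 := sub_nonneg.mpr hR1
  have hQ0 : 0 ≤ Q - 1 := by linarith
  have hq0 : 0 < (q : ℝ) - 1 := by linarith
  refine ⟨by positivity, ?_⟩
  have h1 : (Q - 1) ^ (a + 1) * (R - 1) ≤ Q ^ (a + 1) * R := by gcongr <;> linarith
  have h2 : (Q - 1) ^ a * (R - 1) / ((q : ℝ) - 1) ≤ Q ^ (a + 1) * R := by
    refine (div_le_self (by positivity) (by linarith)).trans ?_
    have : (Q - 1) ^ a ≤ Q ^ (a + 1) :=
      (pow_le_pow_left₀ hQ0 (by linarith) a).trans (pow_le_pow_right₀ (by linarith) (by omega))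
    gcongr
    linarith
  rw [pow_add Q (a + 1) (2 * (a + 1) + 1), ← hR]
  have h3 : 0 ≤ Q ^ (a + 1) * R := by positivity
  have h4 := mul_le_mul_of_nonneg_left (add_le_add h1 h2) (Nat.cast_nonneg (α := ℝ) (a + 1))
  push_cast at h4 ⊢
  nlinarith

theorem S₅_nonneg_and_le {h k q : ℕ} (hh : 1 ≤ h) (hk : k ≠ 0) (hq : 2 ≤ q) :
    0 ≤ S₅ h k q ∧ S₅ h k q ≤
      (2 * h + 1 : ℕ) * (q : ℝ) ^ (k * (2 * h + 1 + (2 * h + 1 + 1) / 2 - 1)) := by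
  obtain ⟨a, rfl⟩ : ∃ a, h = a + 1 := ⟨h - 1, by omega⟩
  have hT : 2 * (a + 1) + 1 + (2 * (a + 1) + 1 + 1) / 2 - 1 = (a + 1) + (2 * (a + 1) + 1) := by omega
  rw [S₅, hT, Nat.add_sub_cancel, mul_comm _ k, pow_mul, pow_mul]
  have hQ := two_le_cast_pow hq hk
  set Q : ℝ := (q : ℝ) ^ k
  set R := Q ^ (2 * (a + 1) + 1) with hR
  have hR1 : 1 ≤ R := one_le_pow₀ (by linarith)
  have hR0 : 0 ≤ R - 1 := sub_nonneg.mpr hR1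
  have hQ0 : 0 ≤ Q - 1 := by linarith
  refine ⟨by positivity, ?_⟩
  have h1 : ((a + 1 : ℕ) : ℝ) * Q * (Q - 1) ^ a * (R - 1) ≤ ((a + 1 : ℕ) : ℝ) * Q * Q ^ a * R := by
    gcongr <;> linarith
  have h2 : (R - 1) / (Q - 1) ≤ Q ^ (a + 1) * R := by
    refine (div_le_self hR0 (by linarith)).trans ?_
    have : 1 ≤ Q ^ (a + 1) := one_le_pow₀ (by linarith)
    nlinarith
  rw [pow_add, ← hR]
  have h3 : 0 ≤ Q ^ (a + 1) * R := by positivity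
  have h4 : 0 ≤ (a : ℝ) * (Q ^ (a + 1) * R) := by positivity
  have h5 : ((a + 1 : ℕ) : ℝ) * Q * Q ^ a * R = ((a + 1 : ℕ) : ℝ) * (Q ^ (a + 1) * R) := by ring
  rw [h5] at h1
  push_cast at h1 ⊢
  linarith

/-- A known size `S` times `q ^ (k - 1)` is at most the size of the new code times a factor that
depends only on `r`. -/
theorem mul_pow_le_mul_size {r k q N : ℕ} (h : IsNewCodeSize q r k N) (hk : 2 ≤ k) (hr : 6 ≤ r)
    (hcomp : ¬ r.Prime) (hq : Even r → 3 ≤ q) {S : ℝ}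
    (hS : S ≤ r * (q : ℝ) ^ (k * (r + (r + 1) / 2 - 1))) :
    S * (q : ℝ) ^ (k - 1) ≤ (r * 2 ^ r.primeFactorsList.sum : ℕ) * N := by
  have hpow : (q : ℝ) ^ (k * (r + (r + 1) / 2 - 1)) * (q : ℝ) ^ (k - 1) ≤
      2 ^ r.primeFactorsList.sum * N := by exact_mod_cast h.pow_le hk hr hcomp hq
  calc S * (q : ℝ) ^ (k - 1)
      ≤ r * (q : ℝ) ^ (k * (r + (r + 1) / 2 - 1)) * (q : ℝ) ^ (k - 1) := by gcongr
    _ = r * ((q : ℝ) ^ (k * (r + (r + 1) / 2 - 1)) * (q : ℝ) ^ (k - 1)) := by ring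
    _ ≤ r * (2 ^ r.primeFactorsList.sum * N) := by gcongr
    _ = _ := by push_cast; ring

theorem IsNewCodeSize.pos {r k q N : ℕ} (h : IsNewCodeSize q r k N) (hk : 2 ≤ k) (hr : 6 ≤ r)
    (hcomp : ¬ r.Prime) (hq : Even r → 3 ≤ q) : 0 < N := by
  have hq0 : 0 < q := by have := h.two_le; omega
  exact Nat.pos_of_mul_pos_left
    (lt_of_lt_of_le (by positivity) (h.pow_le hk hr hcomp hq))

theorem nonneg_and_le_of_mem_knownSizes {r k q : ℕ} (hr : 6 ≤ r) (hk : k ≠ 0) (hq : 2 ≤ q) {s : ℝ}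
    (hs : s ∈ knownSizes r k q) :
    0 ≤ s ∧ s ≤ r * (q : ℝ) ^ (k * (r + (r + 1) / 2 - 1)) := by
  obtain ⟨h, -⟩ | ⟨h, -⟩ | ⟨-, rfl⟩ | ⟨h, hh, rfl, rfl⟩ | ⟨h, hh, rfl, rfl⟩ := hs
  · omega
  · omega
  · exact S₃_nonneg_and_le hr hk hq
  · exact S₄_nonneg_and_le (by omega) hk hq
  · exact S₅_nonneg_and_le (by omega) hk hq

/-- Both limits of the theorem at once: `q` and `k` are functions of a parameter, and all that
matters is that `q ^ (k - 1)` tends to infinity. -/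
theorem knownSizes_isLittleO_size {ι : Type*} {l : Filter ι} {r : ℕ} (hr : 6 ≤ r)
    (hcomp : ¬ r.Prime) {q k size : ι → ℕ}
    (hsize : ∀ᶠ i in l, 2 ≤ k i ∧ (Even r → 3 ≤ q i) ∧ IsNewCodeSize (q i) r (k i) (size i))
    (hlim : Tendsto (fun i ↦ (q i : ℝ) ^ (k i - 1)) l atTop) :
    (fun i ↦ S₃ r (k i) (q i)) =o[l] (fun i ↦ (size i : ℝ)) ∧
    (∀ h, r = 2 * h + 1 →
      (fun i ↦ S₄ h (k i) (q i)) =o[l] (fun i ↦ (size i : ℝ)) ∧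
      (fun i ↦ S₅ h (k i) (q i)) =o[l] (fun i ↦ (size i : ℝ))) ∧
    (∀ᶠ i in l, ∀ s ∈ knownSizes r (k i) (q i), s < (size i : ℝ)) := by
  have hK : 0 < ((r * 2 ^ r.primeFactorsList.sum : ℕ) : ℝ) := by
    have : 0 < r := by omega
    positivity
  set K : ℝ := ((r * 2 ^ r.primeFactorsList.sum : ℕ) : ℝ)
  have hlittle : ∀ S : ι → ℝ, (∀ i, S i ∈ knownSizes r (k i) (q i)) →
      S =o[l] (fun i ↦ (size i : ℝ)) := by
    intro S hS
    rw [isLittleO_iff]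
    intro c hc
    filter_upwards [hsize, hlim.eventually_ge_atTop (K / c)] with i ⟨hk, hq, hN⟩ hi
    obtain ⟨h0, hle⟩ := nonneg_and_le_of_mem_knownSizes hr (by omega) hN.two_le (hS i)
    have hmul := mul_pow_le_mul_size hN hk hr hcomp hq hle
    rw [Real.norm_of_nonneg h0, Real.norm_natCast]
    rw [div_le_iff₀ hc] at hi
    have h1 : S i * K ≤ c * size i * K := by
      calc S i * K ≤ S i * ((q i : ℝ) ^ (k i - 1) * c) := by gcongr
        _ = c * (S i * (q i : ℝ) ^ (k i - 1)) := by ring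
        _ ≤ c * (K * size i) := by gcongr
        _ = c * size i * K := by ring
    exact le_of_mul_le_mul_right h1 hK
  refine ⟨hlittle _ fun i ↦ Or.inr (Or.inr (Or.inl ⟨by omega, rfl⟩)), fun h hh ↦
    ⟨hlittle _ fun i ↦ Or.inr (Or.inr (Or.inr (Or.inl ⟨h, by omega, hh, rfl⟩))),
      hlittle _ fun i ↦ Or.inr (Or.inr (Or.inr (Or.inr ⟨h, by omega, hh, rfl⟩)))⟩, ?_⟩
  filter_upwards [hsize, hlim.eventually_gt_atTop K] with i ⟨hk, hq, hN⟩ hi s hs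
  obtain ⟨h0, hle⟩ := nonneg_and_le_of_mem_knownSizes hr (by omega) hN.two_le hs
  have hmul := mul_pow_le_mul_size hN hk hr hcomp hq hle
  have hpos : (0 : ℝ) < size i := by exact_mod_cast hN.pos hk hr hcomp hq
  obtain rfl | hs0 := h0.eq_or_lt
  · exact hpos
  · refine lt_of_mul_lt_mul_right (a := K) ?_ hK.le
    calc s * K < s * (q i : ℝ) ^ (k i - 1) := by gcongr
      _ ≤ K * size i := hmul
      _ = size i * K := mul_comm _ _

theorem tendsto_cast_pow_sub_one_of_fixed_base {q : ℕ} (hq : 2 ≤ q) :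
    Tendsto (fun k : ℕ ↦ (q : ℝ) ^ (k - 1)) atTop atTop :=
  (tendsto_pow_atTop_atTop_of_one_lt (by exact_mod_cast hq)).comp (tendsto_sub_atTop_nat 1)

theorem tendsto_cast_pow_sub_one_of_fixed_exponent {k : ℕ} (hk : 2 ≤ k) :
    Tendsto (fun q : ℕ ↦ (q : ℝ) ^ (k - 1)) atTop atTop :=
  (tendsto_pow_atTop (by omega)).comp tendsto_natCast_atTop_atTop

end KnownSizes

theorem mainTheorem5 (r : ℕ) (hr : 6 ≤ r) (hcomp : ¬ r.Prime) :
    -- `q` is fixed and `k` tends to infinity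
    (∀ q : ℕ, IsPrimePow q → (Even r → 3 ≤ q) →
      ∀ size : ℕ → ℕ, (∀ k, 2 ≤ k → IsNewCodeSize q r k (size k)) →
        (fun k => S₃ r k q) =o[atTop] (fun k => (size k : ℝ)) ∧
        (∀ h, r = 2 * h + 1 →
          (fun k => S₄ h k q) =o[atTop] (fun k => (size k : ℝ)) ∧
          (fun k => S₅ h k q) =o[atTop] (fun k => (size k : ℝ))) ∧
        (∀ᶠ k in atTop, ∀ s ∈ knownSizes r k q, s < (size k : ℝ))) ∧
    -- `k` is fixed and `q` tends to infinity through the prime powers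
    (∀ k : ℕ, 2 ≤ k →
      ∀ size : ℕ → ℕ,
        (∀ q, IsPrimePow q → (Even r → 3 ≤ q) → IsNewCodeSize q r k (size q)) →
        (fun q => S₃ r k q) =o[atTop ⊓ 𝓟 {q | IsPrimePow q}] (fun q => (size q : ℝ)) ∧
        (∀ h, r = 2 * h + 1 →
          (fun q => S₄ h k q) =o[atTop ⊓ 𝓟 {q | IsPrimePow q}] (fun q => (size q : ℝ)) ∧
          (fun q => S₅ h k q) =o[atTop ⊓ 𝓟 {q | IsPrimePow q}] (fun q => (size q : ℝ))) ∧
        (∀ᶠ q in atTop ⊓ 𝓟 {q | IsPrimePow q}, ∀ s ∈ knownSizes r k q, s < (size q : ℝ))) := by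
  refine ⟨fun q hq hqr size hsize ↦ ?_, fun k hk size hsize ↦ ?_⟩
  · refine knownSizes_isLittleO_size hr hcomp (q := fun _ ↦ q) (k := fun k ↦ k) ?_
      (tendsto_cast_pow_sub_one_of_fixed_base hq.two_le)
    filter_upwards [eventually_ge_atTop 2] with k hk
    exact ⟨hk, hqr, hsize k hk⟩
  · refine knownSizes_isLittleO_size hr hcomp (q := fun q ↦ q) (k := fun _ ↦ k) ?_
      ((tendsto_cast_pow_sub_one_of_fixed_exponent hk).mono_left inf_le_left)
    filter_upwards [mem_inf_of_left (eventually_ge_atTop 3),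
      mem_inf_of_right (mem_principal_self {q | IsPrimePow q})] with q hq3 hq
    exact ⟨hk, fun _ ↦ hq3, hsize q hq fun _ ↦ hq3⟩
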